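/- Let $f$ be a probability density on $\mathbb{R}^d$ with respect to Lebesgue measure, let $F(A)=\int_A f(x)\,\mathrm{d}x$, and write $\operatorname{supp}(f)=\{x\in\mathbb{R}^d: f(x)>0\}$. All cubes below are axis-aligned. We say that $f$ belongs to the fixed-scale support-aware class $\mathcal F_{\mathrm{FSSA}}$ if the following hold. (i) The set of points of $\operatorname{supp}(f)$ at which the restriction of $f$ to $\operatorname{supp}(f)$ is not continuous has $F$-measure zero. There are, moreover, a scale $r>0$, a closed cube $C(r,y)$ of side length $r$ containing $y$ for every $y\in\operatorname{supp}(f)$, and, for every integer $m\ge 1$, a partition $$\operatorname{supp}(f)=A^{(m)}_0\sqcup A^{(m)}_1\sqcup\cdots\sqcup A^{(m)}_m,$$ in which $A^{(m)}_1,\dots,A^{(m)}_m$ are cubes with a common side length $h_m>0$ (products of intervals of length $h_m$, each of which may contain or omit its endpoints), with pairwise disjoint interiors, and with a connected union of closures, such that: (ii) the map $D_r(y)=\log\Bigl(\dfrac{f(y)}{\inf_{z\in C(r,y)}f(z)}\Bigr)\in[0,\infty]$ (equal to $\infty$ if the infimum is $0$) is measurable on $\operatorname{supp}(f)$ and $\int_{\operatorname{supp}(f)}D_r\,\mathrm{d}F<\infty$;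 (iii) there is an integer $M\ge 1$ such that for every $m\ge M$: (a) if $y\in A^{(m)}_0$, then $C(r,y)\cap A^{(m)}_0$ contains a closed cube of side length $r/2$ having $y$ as a vertex; (b) if $y\in\operatorname{supp}(f)\setminus A^{(m)}_0$, then $C(r,y)\cap(\operatorname{supp}(f)\setminus A^{(m)}_0)$ contains a closed cube of side length $r/2$ having $y$ as a vertex. Let $\mathcal M$ be the class of all finite Gaussian mixture densities $x\mapsto\sum_{j=1}^m\pi_j\varphi(x;\mu_j,\Sigma_j)$ on $\mathbb{R}^d$, where $m\in\mathbb{N}$, $\pi_j\ge 0$, $\sum_{j=1}^m\pi_j=1$, $\mu_j\in\mathbb{R}^d$, $\Sigma_j$ is a symmetric positive definite $d\times d$ matrix, and $$\varphi(x;\mu,\Sigma)=(2\pi)^{-d/2}|\Sigma|^{-1/2}\exp\bigl(-\tfrac12(x-\mu)^\top\Sigma^{-1}(x-\mu)\bigr).$$ For densities $f,g$ let $\mathrm{KL}(f\|g)=\int_{\mathbb{R}^d} f(x)\log\frac{f(x)}{g(x)}\,\mathrm{d}x\in[0,\infty]$ denote the Kullback–Leibler divergence. **Theorem.** If $f\in\mathcal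 F_{\mathrm{FSSA}}$, then $$\inf_{g\in\mathcal M}\mathrm{KL}(f\|g)=0\quad\Longleftrightarrow\quad\int_{\mathbb{R}^d}\|x\|^2f(x)\,\mathrm{d}x<\infty,$$ where $\|\cdot\|$ is the Euclidean norm. -/

import Mathlib

open MeasureTheory Set
open scoped ENNReal Matrix

namespace GMMKL

/-- `f` is a (Borel) probability density on `ℝ^d` with respect to Lebesgue measure. -/
structure IsDensity {d : ℕ} (f : EuclideanSpace ℝ (Fin d) → ℝ) : Prop where
  measurable : Measurable f
  nonneg : ∀ x, 0 ≤ f x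
  lintegral_eq_one : ∫⁻ x, ENNReal.ofReal (f x) = 1

/-- The measure `F(A) = ∫_A f(x) dx` with density `f`. -/
noncomputable def densityMeasure {d : ℕ} (f : EuclideanSpace ℝ (Fin d) → ℝ) :
    Measure (EuclideanSpace ℝ (Fin d)) :=
  volume.withDensity fun x => ENNReal.ofReal (f x)

/-- The support convention `supp(f) = {x : f(x) > 0}` (no closure is taken). -/
def posSupp {d : ℕ} (f : EuclideanSpace ℝ (Fin d) → ℝ) : Set (EuclideanSpace ℝ (Fin d)) :=
  {x | 0 < f x}

/-- The Gaussian density `φ(x; μ, S)` with mean `μ` and covariance matrix `S`. -/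
noncomputable def gaussianDensity {d : ℕ} (μ : EuclideanSpace ℝ (Fin d))
    (S : Matrix (Fin d) (Fin d) ℝ) (x : EuclideanSpace ℝ (Fin d)) : ℝ :=
  (2 * Real.pi) ^ (-(d : ℝ) / 2) * S.det ^ (-(1 : ℝ) / 2) *
    Real.exp (-(1 / 2 : ℝ) * ((x - μ).ofLp ⬝ᵥ (S⁻¹ *ᵥ (x - μ).ofLp)))

/-- The class of all finite Gaussian mixture densities on `ℝ^d`
(the number `m` of components is arbitrary; it is positive because the weights sum to `1`). -/
def gaussianMixtures (d : ℕ) : Set (EuclideanSpace ℝ (Fin d) → ℝ) :=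
  {g | ∃ (m : ℕ) (w : Fin m → ℝ) (μ : Fin m → EuclideanSpace ℝ (Fin d))
      (S : Fin m → Matrix (Fin d) (Fin d) ℝ),
      (∀ j, 0 ≤ w j) ∧ ∑ j, w j = 1 ∧ (∀ j, (S j).PosDef) ∧
      g = fun x => ∑ j, w j * gaussianDensity (μ j) (S j) x}

/-- `KL(f ‖ g)` for two densities, with values in `[0, ∞]`. -/
noncomputable def kl {d : ℕ} (f g : EuclideanSpace ℝ (Fin d) → ℝ) : ℝ≥0∞ :=
  InformationTheory.klDiv (densityMeasure f) (densityMeasure g)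

/-- The closed axis-aligned cube with lower corner `a` and side length `s`. -/
def closedCube {d : ℕ} (a : EuclideanSpace ℝ (Fin d)) (s : ℝ) :
    Set (EuclideanSpace ℝ (Fin d)) :=
  {x | ∀ i, x i ∈ Icc (a i) (a i + s)}

/-- `y` is one of the vertices of the cube with lower corner `a` and side length `s`. -/
def IsVertex {d : ℕ} (y a : EuclideanSpace ℝ (Fin d)) (s : ℝ) : Prop :=
  ∀ i, y i = a i ∨ y i = a i + s

/-- `B` contains a closed axis-aligned cube of side length `s` with a vertex at `y`. -/
def ContainsAnchoredCube {d : ℕ} (B : Set (EuclideanSpace ℝ (Fin d)))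
    (y : EuclideanSpace ℝ (Fin d)) (s : ℝ) : Prop :=
  ∃ a, IsVertex y a s ∧ closedCube a s ⊆ B

/-- An axis-aligned cube of side length `h`, each of whose edges may contain or omit each of its
two endpoints: the product of intervals `J i` that lie between `(a i, a i + h)` and
`[a i, a i + h]`. -/
def IsPartitionCube {d : ℕ} (h : ℝ) (B : Set (EuclideanSpace ℝ (Fin d))) : Prop :=
  ∃ (a : EuclideanSpace ℝ (Fin d)) (J : Fin d → Set ℝ),
    (∀ i, Ioo (a i) (a i + h) ⊆ J i ∧ J i ⊆ Icc (a i) (a i + h)) ∧ B = {x | ∀ i, x i ∈ J i}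

/-- A partition `Y = A₀ ⊔ A 1 ⊔ ⋯ ⊔ A m` in which the `A j` are adjacent cubes with common side
length `h`: pairwise disjoint interiors, and the union of the closures is connected. -/
structure IsCubePartition {d : ℕ} (Y : Set (EuclideanSpace ℝ (Fin d))) {m : ℕ} (h : ℝ)
    (A₀ : Set (EuclideanSpace ℝ (Fin d))) (A : Fin m → Set (EuclideanSpace ℝ (Fin d))) :
    Prop where
  side_pos : 0 < h
  isCube : ∀ j, IsPartitionCube h (A j)
  disjoint_interior : Pairwise fun i j => Disjoint (interior (A i)) (interior (A j))
  connected : IsConnected (⋃ j, closure (A j))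
  disjoint : Pairwise fun i j => Disjoint (A i) (A j)
  disjoint_rest : ∀ j, Disjoint A₀ (A j)
  union_eq : A₀ ∪ ⋃ j, A j = Y

/-- The local log-oscillation `log (f(y) / inf_{z ∈ C} f(z))`, as an extended real. If `f(y) > 0`
and the infimum is `0`, it is `∞`; if `y ∈ C` and `f(y) > 0`, it is nonnegative. -/
noncomputable def logOsc {d : ℕ} (f : EuclideanSpace ℝ (Fin d) → ℝ)
    (C : Set (EuclideanSpace ℝ (Fin d))) (y : EuclideanSpace ℝ (Fin d)) : EReal :=
  ENNReal.log (ENNReal.ofReal (f y) / ⨅ z ∈ C, ENNReal.ofReal (f z))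

/-- The fixed-scale support-aware class of densities on `ℝ^d`. Below, `r` is the fixed scale,
`C y` the comparison cube at `y`, and `A₀ m, A m 0, …, A m (m - 1)` the partition of `supp(f)`
into a remainder and `m` adjacent cubes of side length `h m`. -/
structure FSSA {d : ℕ} (f : EuclideanSpace ℝ (Fin d) → ℝ) : Prop where
  isDensity : IsDensity f
  ae_continuous : densityMeasure f {x ∈ posSupp f | ¬ ContinuousWithinAt f (posSupp f) x} = 0
  exists_scale : ∃ (r : ℝ) (C : EuclideanSpace ℝ (Fin d) → Set (EuclideanSpace ℝ (Fin d)))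
    (h : ℕ → ℝ) (A₀ : ℕ → Set (EuclideanSpace ℝ (Fin d)))
    (A : (m : ℕ) → Fin m → Set (EuclideanSpace ℝ (Fin d))),
    0 < r ∧
    (∀ y ∈ posSupp f, y ∈ C y ∧ ∃ a, C y = closedCube a r) ∧
    Measurable (fun y : posSupp f => logOsc f (C y) y) ∧
    ∫⁻ y in posSupp f, (logOsc f (C y) y).toENNReal ∂(densityMeasure f) < ∞ ∧
    (∀ m, 1 ≤ m → IsCubePartition (posSupp f) (h m) (A₀ m) (A m)) ∧
    ∃ M, 1 ≤ M ∧ ∀ m, M ≤ m →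
      (∀ y ∈ A₀ m, ContainsAnchoredCube (C y ∩ A₀ m) y (r / 2)) ∧
      (∀ y ∈ posSupp f \ A₀ m,
        ContainsAnchoredCube (C y ∩ (posSupp f \ A₀ m)) y (r / 2))

end GMMKL

/-!
Why the theorem holds. Write `F` for the measure with density `f`.

*A mixture at finite divergence forces a finite second moment.* A finite Gaussian mixture `g`
satisfies `∫ exp (c ‖x‖²) g < ∞` for some `c > 0`. The pointwise inequality
`t ≤ log (f / g) - 1 + exp t * g / f` with `t = c ‖x‖²`, integrated against `F`, bounds the second
moment of `f` by the integral of `|log (f / g)|` and this exponential moment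
(`lintegral_mul_lt_top_of_kl_lt_top`).

*A finite second moment suffices.* Two facts about `f` are used.

* `f log⁺ f` is integrable (`FSSA.lintegral_log_lt_top`): the infimum of a density over a cube of
  side `r` is at most `r⁻ᵈ`, so `log f` exceeds the local log-oscillation by at most a constant.
* `f` is an `F`-almost everywhere limit of finite Gaussian mixtures `gₙ`
  (`IsDensity.exists_gaussianMixtures_tendsto_ae`). Continuous densities are `L¹`-dense among
  densities; a continuous density is the pointwise limit of its convolutions with narrow Gaussians;
  and such a convolution is, uniformly on compact sets, a limit of finite mixtures, as a Bochner
  integral against a probability measure lies in the closed convex hull of the range.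

For the standard Gaussian `φ` and `0 < δ < 1` the mixtures `(1 - δ) gₙ + δ φ` satisfy
`log (f / ((1 - δ) gₙ + δ φ)) ≤ log⁺ f + ‖x‖² + const`, and this bound is integrable against `F`
by the moment assumption. Dominated convergence for the positive part of this logarithm bounds the infimum
of the divergences by `-log (1 - δ)` (`iInf_kl_le`), and `δ → 0` concludes.
-/

namespace GMMKL

open Filter Topology

/-! ### Divergence of measures given by densities -/

section KL

variable {d : ℕ} {f g : EuclideanSpace ℝ (Fin d) → ℝ}

lemma lintegral_densityMeasure (hf : Measurable f) {u : EuclideanSpace ℝ (Fin d) → ℝ≥0∞}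
    (hu : Measurable u) :
    ∫⁻ x, u x ∂(densityMeasure f) = ∫⁻ x, ENNReal.ofReal (f x) * u x := by
  rw [densityMeasure, lintegral_withDensity_eq_lintegral_mul _ hf.ennreal_ofReal hu]
  rfl

lemma ae_densityMeasure_pos (hf : Measurable f) : ∀ᵐ x ∂(densityMeasure f), 0 < f x := by
  rw [densityMeasure, ae_withDensity_iff hf.ennreal_ofReal]
  exact ae_of_all _ fun x hx => by simpa using hx

lemma IsDensity.isProbabilityMeasure (hf : IsDensity f) :
    IsProbabilityMeasure (densityMeasure f) :=
  ⟨by rw [densityMeasure, withDensity_apply _ MeasurableSet.univ]; simpa using hf.lintegral_eq_one⟩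

lemma IsDensity.integrable (hf : IsDensity f) : Integrable f :=
  (lintegral_ofReal_ne_top_iff_integrable hf.measurable.aestronglyMeasurable
    (ae_of_all _ hf.nonneg)).1 (by simp [hf.lintegral_eq_one])

lemma IsDensity.integral_eq_one (hf : IsDensity f) : ∫ x, f x = 1 := by
  rw [integral_eq_lintegral_of_nonneg_ae (ae_of_all _ hf.nonneg)
    hf.measurable.aestronglyMeasurable, hf.lintegral_eq_one, ENNReal.toReal_one]

lemma isDensity_of_integral_eq_one (hf : Measurable f) (hf0 : ∀ x, 0 ≤ f x)
    (h1 : ∫ x, f x = 1) : IsDensity f := by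
  refine ⟨hf, hf0, ?_⟩
  have hi : Integrable f := by
    by_contra h
    simp [integral_undef h] at h1
  rw [← ofReal_integral_eq_lintegral_ofReal hi (ae_of_all _ hf0), h1, ENNReal.ofReal_one]

lemma densityMeasure_eq_withDensity (hf : Measurable f)
    (hg : Measurable g) (hg0 : ∀ x, 0 < g x) :
    densityMeasure f = (densityMeasure g).withDensity fun x => ENNReal.ofReal (f x / g x) := by
  have hm : Measurable fun x => ENNReal.ofReal (f x / g x) := (hf.div hg).ennreal_ofReal
  rw [densityMeasure, densityMeasure, ← withDensity_mul _ hg.ennreal_ofReal hm]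
  congr 1
  ext x
  rw [Pi.mul_apply, ← ENNReal.ofReal_mul (hg0 x).le, mul_div_cancel₀ _ (hg0 x).ne']

lemma densityMeasure_absolutelyContinuous (hf : Measurable f)
    (hg : Measurable g) (hg0 : ∀ x, 0 < g x) : densityMeasure f ≪ densityMeasure g := by
  rw [densityMeasure_eq_withDensity hf hg hg0]
  exact withDensity_absolutelyContinuous _ _

lemma llr_densityMeasure (hf : Measurable f) (hf0 : ∀ x, 0 ≤ f x)
    (hg : Measurable g) (hg0 : ∀ x, 0 < g x) :
    llr (densityMeasure f) (densityMeasure g)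
      =ᵐ[densityMeasure f] fun x => Real.log (f x / g x) := by
  have hs : SigmaFinite (densityMeasure g) := SigmaFinite.withDensity_ofReal g
  have h := Measure.rnDeriv_withDensity (densityMeasure g) (hf.div hg).ennreal_ofReal
  simp only [Pi.div_apply] at h
  rw [← densityMeasure_eq_withDensity hf hg hg0] at h
  filter_upwards [(densityMeasure_absolutelyContinuous hf hg hg0).ae_le h] with x hx
  rw [llr_def]
  simp only [hx]
  rw [ENNReal.toReal_ofReal (div_nonneg (hf0 x) (hg0 x).le)]

/-- The negative part of `log (f / g)` is always integrable, because `log (g / f) ≤ g / f`; hence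
only the positive part of the log-likelihood ratio is needed to bound the divergence. -/
lemma kl_le_lintegral_log (hf : IsDensity f) (hg : IsDensity g) (hg0 : ∀ x, 0 < g x) :
    kl f g ≤ ∫⁻ x, ENNReal.ofReal (Real.log (f x / g x)) ∂(densityMeasure f) := by
  have := hf.isProbabilityMeasure
  have := hg.isProbabilityMeasure
  rcases eq_or_ne (∫⁻ x, ENNReal.ofReal (Real.log (f x / g x)) ∂(densityMeasure f)) ∞ with h | h
  · simp [h]
  have hm : Measurable fun x => Real.log (f x / g x) := (hf.measurable.div hg.measurable).log
  have hneg : ∫⁻ x, ENNReal.ofReal (-Real.log (f x / g x)) ∂(densityMeasure f) ≤ 1 := by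
    calc ∫⁻ x, ENNReal.ofReal (-Real.log (f x / g x)) ∂(densityMeasure f)
        ≤ ∫⁻ x, ENNReal.ofReal (g x / f x) ∂(densityMeasure f) := by
          refine lintegral_mono fun x => ENNReal.ofReal_le_ofReal ?_
          rw [← Real.log_inv, inv_div]
          exact Real.log_le_self (div_nonneg (hg0 x).le (hf.nonneg x))
      _ = ∫⁻ x, ENNReal.ofReal (f x) * ENNReal.ofReal (g x / f x) :=
          lintegral_densityMeasure hf.measurable (hg.measurable.div hf.measurable).ennreal_ofReal
      _ ≤ ∫⁻ x, ENNReal.ofReal (g x) := by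
          refine lintegral_mono fun x => ?_
          rw [← ENNReal.ofReal_mul (hf.nonneg x)]
          refine ENNReal.ofReal_le_ofReal ?_
          rcases eq_or_ne (f x) 0 with h0 | h0
          · simp [h0, (hg0 x).le]
          · rw [mul_div_cancel₀ _ h0]
      _ = 1 := hg.lintegral_eq_one
  have hint : Integrable (fun x => Real.log (f x / g x)) (densityMeasure f) := by
    refine ⟨hm.aestronglyMeasurable, ?_⟩
    rw [hasFiniteIntegral_iff_norm]
    calc ∫⁻ x, ENNReal.ofReal ‖Real.log (f x / g x)‖ ∂(densityMeasure f)
        ≤ ∫⁻ x, (ENNReal.ofReal (Real.log (f x / g x)) + ENNReal.ofReal (-Real.log (f x / g x)))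
            ∂(densityMeasure f) := by
          refine lintegral_mono fun x => ?_
          rw [Real.norm_eq_abs]
          rcases abs_cases (Real.log (f x / g x)) with hx | hx <;> rw [hx.1] <;> simp
      _ < ∞ := by
          rw [lintegral_add_left hm.ennreal_ofReal]
          exact ENNReal.add_lt_top.2 ⟨h.lt_top, hneg.trans_lt ENNReal.one_lt_top⟩
  have hllr := llr_densityMeasure hf.measurable hf.nonneg hg.measurable hg0
  rw [kl, InformationTheory.klDiv_of_ac_of_integrable
    (densityMeasure_absolutelyContinuous hf.measurable hg.measurable hg0)
    ((integrable_congr hllr).2 hint), integral_congr_ae hllr]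
  simp only [probReal_univ, add_sub_cancel_right]
  refine (ENNReal.ofReal_le_ofReal (integral_mono hint hint.pos_part
    fun x => le_max_left _ 0)).trans ?_
  rw [ofReal_integral_eq_lintegral_ofReal hint.pos_part (ae_of_all _ fun x => le_max_right _ _)]
  exact lintegral_mono fun x => by simp

/-- If `kl f g` is finite, then every function with a finite exponential integral against `g` has
a finite integral against `f`. This is the Donsker–Varadhan bound in the pointwise form
`t ≤ log (f / g) - 1 + exp t * g / f`. -/
lemma lintegral_mul_lt_top_of_kl_lt_top (hf : Measurable f) (hf0 : ∀ x, 0 ≤ f x)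
    (hg : Measurable g) (hg0 : ∀ x, 0 < g x) (hkl : kl f g < ∞)
    {t : EuclideanSpace ℝ (Fin d) → ℝ}
    (hi : Integrable fun x => Real.exp (t x) * g x) :
    ∫⁻ x, ENNReal.ofReal (t x * f x) < ∞ := by
  obtain ⟨-, hllr⟩ := InformationTheory.klDiv_ne_top_iff.1 hkl.ne
  rw [integrable_congr (llr_densityMeasure hf hf0 hg hg0)] at hllr
  have hm : Measurable fun x => Real.log (f x / g x) := (hf.div hg).log
  have h1 : ∫⁻ x, ENNReal.ofReal (f x) * ENNReal.ofReal ‖Real.log (f x / g x)‖ < ∞ := by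
    rw [← lintegral_densityMeasure hf hm.norm.ennreal_ofReal]
    exact (hasFiniteIntegral_iff_norm _).1 hllr.2
  have h2 : ∫⁻ x, ENNReal.ofReal (Real.exp (t x) * g x) < ∞ :=
    (hasFiniteIntegral_iff_ofReal
      (ae_of_all _ fun x => mul_nonneg (Real.exp_pos _).le (hg0 x).le)).1 hi.2
  refine lt_of_le_of_lt ?_ (ENNReal.add_lt_top.2 ⟨h1, h2⟩)
  have hm' : Measurable fun x => ENNReal.ofReal (f x) * ENNReal.ofReal ‖Real.log (f x / g x)‖ :=
    hf.ennreal_ofReal.mul hm.norm.ennreal_ofReal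
  rw [← lintegral_add_left hm']
  refine lintegral_mono fun x => ?_
  have hb : 0 ≤ Real.exp (t x) * g x := mul_nonneg (Real.exp_pos _).le (hg0 x).le
  rw [← ENNReal.ofReal_mul (hf0 x),
    ← ENNReal.ofReal_add (mul_nonneg (hf0 x) (norm_nonneg _)) hb]
  refine ENNReal.ofReal_le_ofReal ?_
  rcases (hf0 x).eq_or_lt with h0 | h0
  · simp [← h0, hb]
  have hq : 0 < f x / g x := div_pos h0 (hg0 x)
  have key : t x ≤ Real.log (f x / g x) + Real.exp (t x) * (g x / f x) := by
    have := Real.add_one_le_exp (t x - Real.log (f x / g x))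
    rw [Real.exp_sub, Real.exp_log hq, div_div_eq_mul_div, ← mul_div] at this
    linarith
  have hn : Real.log (f x / g x) ≤ ‖Real.log (f x / g x)‖ := Real.le_norm_self _
  calc t x * f x ≤ (‖Real.log (f x / g x)‖ + Real.exp (t x) * (g x / f x)) * f x := by
        gcongr; linarith
    _ = _ := by field_simp

end KL

/-! ### Gaussian densities and their mixtures -/

section Gaussian

variable {d : ℕ}

lemma continuous_gaussianDensity {X : Type*} [TopologicalSpace X]
    {u v : X → EuclideanSpace ℝ (Fin d)} (hu : Continuous u) (hv : Continuous v)
    (S : Matrix (Fin d) (Fin d) ℝ) : Continuous fun z => gaussianDensity (u z) S (v z) := by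
  unfold gaussianDensity
  simp only [dotProduct, Matrix.mulVec]
  fun_prop

lemma gaussianDensity_pos (μ : EuclideanSpace ℝ (Fin d)) {S : Matrix (Fin d) (Fin d) ℝ}
    (hS : S.PosDef) (x : EuclideanSpace ℝ (Fin d)) : 0 < gaussianDensity μ S x := by
  have := hS.det_pos
  unfold gaussianDensity
  positivity

/-- A positive definite quadratic form on `ℝ^d` is bounded below by a multiple of the squared
norm, by compactness of the unit sphere. -/
lemma exists_mul_norm_sq_le {T : Matrix (Fin d) (Fin d) ℝ} (hT : T.PosDef) :
    ∃ c > 0, ∀ x : EuclideanSpace ℝ (Fin d), c * ‖x‖ ^ 2 ≤ x.ofLp ⬝ᵥ (T *ᵥ x.ofLp) := by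
  have hcont : Continuous fun x : EuclideanSpace ℝ (Fin d) => x.ofLp ⬝ᵥ (T *ᵥ x.ofLp) := by
    simp only [dotProduct, Matrix.mulVec]
    fun_prop
  rcases (Metric.sphere (0 : EuclideanSpace ℝ (Fin d)) 1).eq_empty_or_nonempty with he | hne
  · refine ⟨1, one_pos, fun x => ?_⟩
    have hx : x = 0 := by
      by_contra hx
      have : (‖x‖⁻¹ • x) ∈ Metric.sphere (0 : EuclideanSpace ℝ (Fin d)) 1 := by
        simp [norm_smul, hx]
      rw [he] at this
      exact this
    simp [hx]
  · obtain ⟨z, hz, hmin⟩ := (isCompact_sphere _ _).exists_isMinOn hne hcont.continuousOn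
    have hz1 : ‖z‖ = 1 := by simpa using hz
    have hz0 : z.ofLp ≠ 0 := by
      intro h
      have : z = 0 := by ext i; simp [h]
      simp [this] at hz1
    refine ⟨z.ofLp ⬝ᵥ (T *ᵥ z.ofLp), by simpa using hT.dotProduct_mulVec_pos hz0, fun x => ?_⟩
    rcases eq_or_ne x 0 with rfl | hx
    · simp
    have hn : 0 < ‖x‖ := norm_pos_iff.2 hx
    have h := hmin (a := ‖x‖⁻¹ • x) (by simp [norm_smul, hx])
    simp only [Set.mem_ofPred_eq, WithLp.ofLp_smul, Matrix.mulVec_smul, smul_dotProduct,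
      dotProduct_smul, smul_eq_mul] at h
    calc _ ≤ (‖x‖⁻¹ * (‖x‖⁻¹ * (x.ofLp ⬝ᵥ T *ᵥ x.ofLp))) * ‖x‖ ^ 2 := by gcongr
      _ = _ := by field_simp

lemma integrable_exp_neg_mul_norm_sq {b : ℝ} (hb : 0 < b) :
    Integrable fun x : EuclideanSpace ℝ (Fin d) => Real.exp (-b * ‖x‖ ^ 2) := by
  by_contra h
  have h1 := GaussianFourier.integral_rexp_neg_mul_sq_norm (V := EuclideanSpace ℝ (Fin d)) hb
  rw [integral_undef h] at h1
  have : 0 < (Real.pi / b) ^ (Module.finrank ℝ (EuclideanSpace ℝ (Fin d)) / 2 : ℝ) :=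
    Real.rpow_pos_of_pos (div_pos Real.pi_pos hb) _
  exact this.ne h1

/-- Every Gaussian has square-exponential moments. -/
lemma eventually_integrable_exp_mul_gaussianDensity (μ : EuclideanSpace ℝ (Fin d))
    {S : Matrix (Fin d) (Fin d) ℝ} (hS : S.PosDef) :
    ∀ᶠ c : ℝ in 𝓝[>] 0, Integrable fun x => Real.exp (c * ‖x‖ ^ 2) * gaussianDensity μ S x := by
  obtain ⟨b, hb, hq⟩ := exists_mul_norm_sq_le hS.inv
  filter_upwards [Ioo_mem_nhdsGT (show 0 < b / 8 by positivity)] with c hc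
  have hcont : Continuous fun x : EuclideanSpace ℝ (Fin d) =>
      Real.exp (c * ‖x‖ ^ 2) * gaussianDensity μ S x :=
    (by fun_prop : Continuous fun x : EuclideanSpace ℝ (Fin d) => Real.exp (c * ‖x‖ ^ 2)).mul
      (continuous_gaussianDensity continuous_const continuous_id S)
  obtain ⟨K, hK⟩ : ∃ K : ℝ, K = (2 * Real.pi) ^ (-(d : ℝ) / 2) * S.det ^ (-(1 : ℝ) / 2) :=
    ⟨_, rfl⟩
  have hK0 : 0 < K := by rw [hK]; have := hS.det_pos; positivity
  refine ((integrable_exp_neg_mul_norm_sq (d := d) (show 0 < b / 8 by positivity)).const_mul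
    (K * Real.exp (b / 2 * ‖μ‖ ^ 2))).mono' hcont.aestronglyMeasurable (ae_of_all _ fun x => ?_)
  rw [Real.norm_of_nonneg (mul_nonneg (Real.exp_pos _).le (gaussianDensity_pos μ hS x).le)]
  unfold gaussianDensity
  rw [← hK, mul_left_comm, ← Real.exp_add, mul_assoc, ← Real.exp_add]
  refine mul_le_mul_of_nonneg_left (Real.exp_le_exp.2 ?_) hK0.le
  have h1 := hq (x - μ)
  have h2 : ‖x‖ ^ 2 ≤ 2 * ‖x - μ‖ ^ 2 + 2 * ‖μ‖ ^ 2 := by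
    have h3 : ‖x‖ ≤ ‖x - μ‖ + ‖μ‖ := by simpa using norm_add_le (x - μ) μ
    nlinarith [norm_nonneg x, norm_nonneg (x - μ), norm_nonneg μ, sq_nonneg (‖x - μ‖ - ‖μ‖)]
  have h4 : c * ‖x‖ ^ 2 ≤ b / 8 * ‖x‖ ^ 2 := by gcongr; exact hc.2.le
  nlinarith

/-- The Gaussian density with covariance `s • 1`, in closed form. -/
lemma gaussianDensity_smul_one (μ : EuclideanSpace ℝ (Fin d)) {s : ℝ} (hs : 0 < s)
    (x : EuclideanSpace ℝ (Fin d)) :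
    gaussianDensity μ (s • 1) x =
      (2 * Real.pi * s) ^ (-(d : ℝ) / 2) * Real.exp (-(2 * s)⁻¹ * ‖x - μ‖ ^ 2) := by
  have hdet : (s • (1 : Matrix (Fin d) (Fin d) ℝ)).det = s ^ (d : ℝ) := by simp
  have hinv : (s • (1 : Matrix (Fin d) (Fin d) ℝ))⁻¹ = s⁻¹ • 1 := by
    refine Matrix.inv_eq_right_inv ?_
    simp [smul_smul, hs.ne']
  unfold gaussianDensity
  rw [hdet, hinv, ← Real.rpow_mul hs.le, Real.mul_rpow (by positivity) hs.le,
    EuclideanSpace.real_norm_sq_eq]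
  congr 1
  · congr 2; ring
  · congr 1
    rw [Matrix.smul_mulVec, Matrix.one_mulVec, dotProduct_smul, smul_eq_mul, dotProduct, mul_inv]
    simp only [← pow_two]
    ring

lemma posDef_smul_one {s : ℝ} (hs : 0 < s) : (s • (1 : Matrix (Fin d) (Fin d) ℝ)).PosDef :=
  Matrix.PosDef.one.smul hs

open scoped MatrixOrder in
lemma exists_eq_transpose_mul_self {T : Matrix (Fin d) (Fin d) ℝ} (hT : T.PosDef) :
    ∃ B : Matrix (Fin d) (Fin d) ℝ, T = Bᵀ * B := by
  obtain ⟨B, hB⟩ := CStarAlgebra.nonneg_iff_eq_star_mul_self.mp hT.posSemidef.nonneg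
  exact ⟨B, by simpa [Matrix.star_eq_conjTranspose] using hB⟩

/-- The substitution `y = B x`, where `S⁻¹ = Bᵀ * B`, reduces the integral of a Gaussian density
to the standard Gaussian integral. -/
lemma integral_gaussianDensity (μ : EuclideanSpace ℝ (Fin d))
    {S : Matrix (Fin d) (Fin d) ℝ} (hS : S.PosDef) : ∫ x, gaussianDensity μ S x = 1 := by
  obtain ⟨B, hB⟩ := exists_eq_transpose_mul_self hS.inv
  have hSd := hS.det_pos
  have hBd : B.det ^ 2 = S.det⁻¹ := by
    have h := congrArg Matrix.det hB
    rw [Matrix.det_mul, Matrix.det_transpose, Matrix.det_nonsing_inv, Ring.inverse_eq_inv'] at h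
    rw [h, pow_two]
  have hB0 : B.det ≠ 0 := fun h => by
    rw [h] at hBd
    exact (inv_pos.2 hSd).ne (by simpa using hBd)
  have hLd : LinearMap.det (Matrix.toLpLin 2 2 B) = B.det := by
    rw [Matrix.toLpLin_eq_toLin, LinearMap.det_toLin]
  have hq : ∀ z : EuclideanSpace ℝ (Fin d),
      z.ofLp ⬝ᵥ (S⁻¹ *ᵥ z.ofLp) = ‖Matrix.toLpLin 2 2 B z‖ ^ 2 := fun z => by
    rw [hB, ← Matrix.mulVec_mulVec, Matrix.dotProduct_mulVec, Matrix.vecMul_transpose,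
      EuclideanSpace.real_norm_sq_eq]
    simp only [dotProduct, ← pow_two]
    rfl
  have hmap := Measure.map_linearMap_addHaar_eq_smul_addHaar
    (volume : Measure (EuclideanSpace ℝ (Fin d))) (f := Matrix.toLpLin 2 2 B) (hLd ▸ hB0)
  unfold gaussianDensity
  rw [integral_const_mul, integral_sub_right_eq_self (fun x : EuclideanSpace ℝ (Fin d) =>
    Real.exp (-(1 / 2 : ℝ) * (x.ofLp ⬝ᵥ (S⁻¹ *ᵥ x.ofLp)))) μ]
  simp_rw [hq]
  rw [← integral_map (μ := volume) (φ := Matrix.toLpLin 2 2 B)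
    (f := fun y => Real.exp (-(1 / 2 : ℝ) * ‖y‖ ^ 2))
    (LinearMap.continuous_of_finiteDimensional _).aemeasurable
    (by fun_prop : Continuous fun y : EuclideanSpace ℝ (Fin d) =>
      Real.exp (-(1 / 2 : ℝ) * ‖y‖ ^ 2)).aestronglyMeasurable,
    hmap, integral_smul_measure, GaussianFourier.integral_rexp_neg_mul_sq_norm (by norm_num),
    finrank_euclideanSpace_fin, hLd, ENNReal.toReal_ofReal (abs_nonneg _), smul_eq_mul]
  have h1 : |B.det⁻¹| = S.det ^ ((1 : ℝ) / 2) := by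
    rw [← Real.sqrt_sq_eq_abs, inv_pow, hBd, inv_inv, Real.sqrt_eq_rpow]
  rw [h1, neg_div, neg_div, Real.rpow_neg (by positivity), Real.rpow_neg hSd.le,
    show Real.pi / (1 / 2) = 2 * Real.pi by ring]
  field_simp

lemma gaussianMixtures_pos {g : EuclideanSpace ℝ (Fin d) → ℝ} (hg : g ∈ gaussianMixtures d)
    (x : EuclideanSpace ℝ (Fin d)) : 0 < g x := by
  obtain ⟨m, w, μ, S, hw, hw1, hS, rfl⟩ := hg
  obtain ⟨j, -, hj⟩ : ∃ j ∈ Finset.univ, w j ≠ 0 := by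
    refine Finset.exists_ne_zero_of_sum_ne_zero ?_
    rw [hw1]; exact one_ne_zero
  exact Finset.sum_pos' (fun i _ => mul_nonneg (hw i) (gaussianDensity_pos _ (hS i) x).le)
    ⟨j, Finset.mem_univ j, mul_pos ((hw j).lt_of_ne' hj) (gaussianDensity_pos _ (hS j) x)⟩

lemma gaussianMixtures_continuous {g : EuclideanSpace ℝ (Fin d) → ℝ}
    (hg : g ∈ gaussianMixtures d) : Continuous g := by
  obtain ⟨m, w, μ, S, hw, hw1, hS, rfl⟩ := hg
  exact continuous_finsetSum _ fun j _ => continuous_const.mul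
    (continuous_gaussianDensity continuous_const continuous_id (S j))

lemma gaussianMixtures_isDensity {g : EuclideanSpace ℝ (Fin d) → ℝ}
    (hg : g ∈ gaussianMixtures d) : IsDensity g := by
  refine isDensity_of_integral_eq_one (gaussianMixtures_continuous hg).measurable
    (fun x => (gaussianMixtures_pos hg x).le) ?_
  obtain ⟨m, w, μ, S, hw, hw1, hS, rfl⟩ := hg
  have hi : ∀ j, Integrable (gaussianDensity (μ j) (S j)) := fun j => by
    by_contra h
    have h1 := integral_gaussianDensity (μ j) (hS j)
    rw [integral_undef h] at h1
    exact zero_ne_one h1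
  rw [integral_finsetSum _ fun j _ => (hi j).const_mul (w j)]
  simp_rw [integral_const_mul, integral_gaussianDensity _ (hS _), mul_one, hw1]

lemma exists_integrable_exp_mul_gaussianMixture {g : EuclideanSpace ℝ (Fin d) → ℝ}
    (hg : g ∈ gaussianMixtures d) :
    ∃ c > 0, Integrable fun x => Real.exp (c * ‖x‖ ^ 2) * g x := by
  obtain ⟨m, w, μ, S, hw, hw1, hS, rfl⟩ := hg
  have h := eventually_all.2 fun j => eventually_integrable_exp_mul_gaussianDensity (μ j) (hS j)
  obtain ⟨c, hc, hc0⟩ := (h.and self_mem_nhdsWithin).exists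
  refine ⟨c, hc0, ?_⟩
  simp_rw [Finset.mul_sum, mul_left_comm _ (w _)]
  exact integrable_finsetSum _ fun j _ => (hc j).const_mul (w j)

lemma convex_gaussianMixtures : Convex ℝ (gaussianMixtures d) := by
  rintro _ ⟨m, w, μ, S, hw, hw1, hS, rfl⟩ _ ⟨m', w', μ', S', hw', hw1', hS', rfl⟩ a b ha hb hab
  refine ⟨m + m', Fin.append (a • w) (b • w'), Fin.append μ μ', Fin.append S S', ?_, ?_, ?_, ?_⟩
  · refine Fin.addCases (fun i => ?_) fun i => ?_
    · simpa using mul_nonneg ha (hw i)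
    · simpa using mul_nonneg hb (hw' i)
  · simp [Fin.sum_univ_add, ← Finset.mul_sum, hw1, hw1', hab]
  · refine Fin.addCases (fun i => ?_) fun i => ?_
    · simpa using hS i
    · simpa using hS' i
  · ext x
    simp [Fin.sum_univ_add, Finset.mul_sum, mul_assoc]

lemma gaussianDensity_mem_gaussianMixtures (μ : EuclideanSpace ℝ (Fin d))
    {S : Matrix (Fin d) (Fin d) ℝ} (hS : S.PosDef) : gaussianDensity μ S ∈ gaussianMixtures d :=
  ⟨1, fun _ => 1, fun _ => μ, fun _ => S, by simp, by simp, fun _ => hS, by simp⟩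

end Gaussian

/-! ### Approximation of densities by Gaussian mixtures -/

section Approximation

/-- Almost everywhere sequential closure is idempotent: a limit of limits of sequences in `M` is
itself a limit of a sequence in `M`. The diagonal sequence converges by Borel–Cantelli. -/
lemma exists_seq_tendsto_ae_of_tendsto_ae {α : Type*} [MeasurableSpace α] {μ : Measure α}
    [IsFiniteMeasure μ] {M : Set (α → ℝ)} (hM : ∀ g ∈ M, AEStronglyMeasurable g μ)
    {h : ℕ → α → ℝ} {f : α → ℝ} (hlim : ∀ᵐ x ∂μ, Tendsto (fun n => h n x) atTop (𝓝 (f x)))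
    (happ : ∀ n, ∃ g : ℕ → α → ℝ, (∀ k, g k ∈ M) ∧
      ∀ᵐ x ∂μ, Tendsto (fun k => g k x) atTop (𝓝 (h n x))) :
    ∃ g : ℕ → α → ℝ, (∀ k, g k ∈ M) ∧ ∀ᵐ x ∂μ, Tendsto (fun k => g k x) atTop (𝓝 (f x)) := by
  have key : ∀ n : ℕ, ∃ q ∈ M, μ {x | (1 / 2 : ℝ) ^ n ≤ dist (q x) (h n x)} ≤ 2⁻¹ ^ n := by
    intro n
    obtain ⟨g, hg, hgt⟩ := happ n
    have hm := tendstoInMeasure_iff_dist.1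
      (tendstoInMeasure_of_tendsto_ae (fun k => hM _ (hg k)) hgt) ((1 / 2 : ℝ) ^ n) (by positivity)
    have hpos : (0 : ℝ≥0∞) < 2⁻¹ ^ n := ENNReal.pow_pos (by simp) n
    obtain ⟨k, hk⟩ := (hm.eventually (eventually_le_nhds hpos)).exists
    exact ⟨g k, hg k, hk⟩
  choose q hqM hq using key
  refine ⟨q, hqM, ?_⟩
  have hsum : ∑' n, μ {x | (1 / 2 : ℝ) ^ n ≤ dist (q n x) (h n x)} ≠ ∞ :=
    ne_top_of_le_ne_top (by rw [ENNReal.tsum_geometric]; simp) (ENNReal.tsum_le_tsum hq)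
  filter_upwards [hlim, ae_eventually_notMem hsum] with x hx hev
  have h0 : Tendsto (fun n => q n x - h n x) atTop (𝓝 0) := by
    refine squeeze_zero_norm' ?_
      (tendsto_pow_atTop_nhds_zero_of_lt_one (by norm_num) (by norm_num : (1 / 2 : ℝ) < 1))
    filter_upwards [hev] with n hn
    rw [Real.norm_eq_abs, ← Real.dist_eq]
    exact (not_le.1 hn).le
  simpa using h0.add hx

variable {d : ℕ}

/-- Continuous densities are `L¹`-dense among densities. -/
lemma IsDensity.exists_continuous_integral_sub_le {f : EuclideanSpace ℝ (Fin d) → ℝ}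
    (hf : IsDensity f) {ε : ℝ} (hε : 0 < ε) :
    ∃ p, IsDensity p ∧ Continuous p ∧ ∫ x, ‖f x - p x‖ ≤ ε := by
  obtain ⟨η, hη, hη1, hη2⟩ : ∃ η : ℝ, 0 < η ∧ η ≤ 1 / 2 ∧ 2 * η ≤ ε :=
    ⟨min (ε / 2) (1 / 2), by positivity, min_le_right _ _, by
      linarith [min_le_left (ε / 2) (1 / 2)]⟩
  -- The approximant is the positive part of a continuous function `u`, divided by its integral
  -- `c`; each of the two modifications costs at most `η` in `L¹`.
  obtain ⟨u, -, hu, huc, hui⟩ := hf.integrable.exists_hasCompactSupport_integral_sub_le hη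
  have hvc : Continuous fun x => max (u x) 0 := huc.max continuous_const
  have hvi : Integrable fun x => max (u x) 0 := hui.pos_part
  have hfv : ∫ x, ‖f x - max (u x) 0‖ ≤ η := by
    refine le_trans (integral_mono (hf.integrable.sub hvi).norm (hf.integrable.sub hui).norm
      fun x => ?_) hu
    have := abs_max_sub_max_le_abs (f x) (u x) 0
    rwa [max_eq_left (hf.nonneg x)] at this
  set c : ℝ := ∫ x, max (u x) 0 with hc
  have hc1 : |1 - c| ≤ η := by
    rw [← hf.integral_eq_one, hc, ← integral_sub hf.integrable hvi]
    exact (norm_integral_le_integral_norm _).trans hfv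
  have hc0 : 0 < c := by linarith [(abs_le.1 hc1).2]
  have hpi : Integrable fun x => max (u x) 0 / c := hvi.div_const c
  refine ⟨fun x => max (u x) 0 / c, isDensity_of_integral_eq_one (hvc.div_const c).measurable
    (fun x => div_nonneg (le_max_right _ _) hc0.le) ?_, hvc.div_const c, ?_⟩
  · rw [integral_div, ← hc, div_self hc0.ne']
  · have hsub : ∀ x, ‖max (u x) 0 - max (u x) 0 / c‖ = max (u x) 0 * (|c - 1| / c) := fun x => by
      rw [show max (u x) 0 - max (u x) 0 / c = max (u x) 0 * ((c - 1) / c) by field_simp,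
        norm_mul, Real.norm_of_nonneg (le_max_right _ _), Real.norm_eq_abs, abs_div,
        abs_of_pos hc0]
    calc ∫ x, ‖f x - max (u x) 0 / c‖
        ≤ ∫ x, (‖f x - max (u x) 0‖ + ‖max (u x) 0 - max (u x) 0 / c‖) :=
          integral_mono (hf.integrable.sub hpi).norm
            ((hf.integrable.sub hvi).norm.add (hvi.sub hpi).norm)
            fun x => norm_sub_le_norm_sub_add_norm_sub _ _ _
      _ = (∫ x, ‖f x - max (u x) 0‖) + |1 - c| := by
          refine (integral_add (hf.integrable.sub hvi).norm (hvi.sub hpi).norm).trans ?_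
          simp only [Pi.sub_apply, hsub]
          rw [integral_mul_const, ← hc, mul_div_cancel₀ _ hc0.ne', abs_sub_comm]
      _ ≤ ε := by linarith

/-- Gaussian smoothing with covariance `c⁻² • 1` recovers a continuous integrable function as
`c → ∞`. -/
lemma tendsto_integral_gaussianDensity_mul {p : EuclideanSpace ℝ (Fin d) → ℝ}
    (hp : Integrable p) (hpc : Continuous p) (x : EuclideanSpace ℝ (Fin d)) :
    Tendsto (fun c : ℝ => ∫ y, gaussianDensity y ((c ^ 2)⁻¹ • 1) x * p y) atTop (𝓝 (p x)) := by
  have hφ : ∀ z : EuclideanSpace ℝ (Fin d), gaussianDensity 0 1 z =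
      (2 * Real.pi) ^ (-(d : ℝ) / 2) * Real.exp (-2⁻¹ * ‖z‖ ^ 2) := fun z => by
    simpa using gaussianDensity_smul_one 0 one_pos z
  have h1 : ∫ z : EuclideanSpace ℝ (Fin d), gaussianDensity 0 1 z = 1 :=
    integral_gaussianDensity 0 Matrix.PosDef.one
  have hdecay : Tendsto (fun z : EuclideanSpace ℝ (Fin d) =>
      ‖z‖ ^ Module.finrank ℝ (EuclideanSpace ℝ (Fin d)) * gaussianDensity 0 1 z)
      (Bornology.cobounded _) (𝓝 0) := by
    have h2 : Tendsto (fun t : ℝ => (2 * Real.pi) ^ (-(d : ℝ) / 2) * Real.exp 2⁻¹ *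
        (t ^ d * Real.exp (-t))) atTop (𝓝 0) := by
      simpa using (Real.tendsto_pow_mul_exp_neg_atTop_nhds_zero d).const_mul
        ((2 * Real.pi) ^ (-(d : ℝ) / 2) * Real.exp 2⁻¹)
    refine squeeze_zero (fun z => mul_nonneg (by positivity)
      (gaussianDensity_pos 0 Matrix.PosDef.one z).le) (fun z => ?_)
      (h2.comp tendsto_norm_cobounded_atTop)
    rw [hφ, finrank_euclideanSpace_fin, Function.comp_apply]
    have h3 : Real.exp (-2⁻¹ * ‖z‖ ^ 2) ≤ Real.exp 2⁻¹ * Real.exp (-‖z‖) := by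
      rw [← Real.exp_add]
      exact Real.exp_le_exp.2 (by nlinarith [sq_nonneg (‖z‖ - 1)])
    calc ‖z‖ ^ d * ((2 * Real.pi) ^ (-(d : ℝ) / 2) * Real.exp (-2⁻¹ * ‖z‖ ^ 2))
        ≤ ‖z‖ ^ d * ((2 * Real.pi) ^ (-(d : ℝ) / 2) * (Real.exp 2⁻¹ * Real.exp (-‖z‖))) := by
          gcongr
      _ = _ := by ring
  refine (tendsto_integral_comp_smul_smul_of_integrable'
    (fun z => (gaussianDensity_pos 0 Matrix.PosDef.one z).le) h1 hdecay hp
    hpc.continuousAt (x₀ := x)).congr' ?_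
  filter_upwards [eventually_gt_atTop 0] with c hc
  refine integral_congr_ae (ae_of_all _ fun y => ?_)
  have hc2 : 0 < (c ^ 2)⁻¹ := by positivity
  simp only [smul_eq_mul]
  rw [hφ, gaussianDensity_smul_one y hc2, finrank_euclideanSpace_fin, norm_smul, mul_pow,
    Real.norm_of_nonneg hc.le, Real.mul_rpow (by positivity) hc2.le]
  have h4 : ((c ^ 2)⁻¹ : ℝ) ^ (-(d : ℝ) / 2) = c ^ d := by
    rw [← Real.rpow_natCast c 2, ← Real.rpow_neg hc.le, ← Real.rpow_mul hc.le,
      ← Real.rpow_natCast c d]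
    congr 1
    push_cast
    ring
  rw [h4, mul_inv, inv_inv, ← mul_assoc, mul_comm (c ^ d)]
  congr 3
  ring

/-- A continuous mixture of Gaussians with a fixed covariance is a uniform limit, on any compact
set `K`, of finite mixtures: as an element of `C(K, ℝ)` it is a Bochner integral of Gaussians, and
so lies in the closed convex hull of these. -/
lemma exists_gaussianMixture_dist_integral_lt (ν : Measure (EuclideanSpace ℝ (Fin d)))
    [IsProbabilityMeasure ν] {S : Matrix (Fin d) (Fin d) ℝ} (hS : S.PosDef)
    {K : Set (EuclideanSpace ℝ (Fin d))} (hK : IsCompact K) {ε : ℝ} (hε : 0 < ε) :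
    ∃ g ∈ gaussianMixtures d, ∀ x ∈ K, dist (∫ y, gaussianDensity y S x ∂ν) (g x) < ε := by
  have : CompactSpace K := isCompact_iff_compactSpace.1 hK
  let Φ : C(EuclideanSpace ℝ (Fin d), C(K, ℝ)) := ContinuousMap.curry
    ⟨fun p => gaussianDensity p.1 S p.2, continuous_gaussianDensity continuous_fst
      (continuous_subtype_val.comp continuous_snd) S⟩
  have hΦ : ∀ y (x : K), Φ y x = gaussianDensity y S x := fun _ _ => rfl
  have hdet := hS.det_pos
  have hΦi : Integrable Φ ν := by
    refine Integrable.of_bound Φ.continuous.aestronglyMeasurable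
      ((2 * Real.pi) ^ (-(d : ℝ) / 2) * S.det ^ (-(1 : ℝ) / 2)) (ae_of_all _ fun y => ?_)
    refine (ContinuousMap.norm_le _ (by positivity)).2 fun x => ?_
    rw [hΦ, Real.norm_of_nonneg (gaussianDensity_pos y hS x).le]
    refine mul_le_of_le_one_right (by positivity) (Real.exp_le_one_iff.2 ?_)
    have := hS.inv.posSemidef.dotProduct_mulVec_nonneg ((x : EuclideanSpace ℝ (Fin d)) - y).ofLp
    simp only [star_trivial] at this
    linarith
  let T : Set C(K, ℝ) := {u | ∃ g ∈ gaussianMixtures d, ∀ x : K, u x = g x}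
  have hT : Convex ℝ T := by
    rintro u ⟨g, hg, hu⟩ v ⟨g', hg', hv⟩ a b ha hb hab
    exact ⟨a • g + b • g', convex_gaussianMixtures hg hg' ha hb hab, fun x => by simp [hu, hv]⟩
  have hmem : ∫ y, Φ y ∂ν ∈ closure T := by
    refine hT.closure.integral_mem isClosed_closure (ae_of_all _ fun y => ?_) hΦi
    exact subset_closure ⟨_, gaussianDensity_mem_gaussianMixtures y hS, hΦ y⟩
  obtain ⟨u, ⟨g, hg, hu⟩, hd⟩ := Metric.mem_closure_iff.1 hmem ε hε
  refine ⟨g, hg, fun x hx => lt_of_le_of_lt ?_ hd⟩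
  have h := ContinuousMap.dist_apply_le_dist (f := ∫ y, Φ y ∂ν) (g := u) ⟨x, hx⟩
  rwa [hu, ContinuousMap.integral_apply hΦi] at h

/-- A continuous density is a pointwise limit of finite Gaussian mixtures. -/
lemma IsDensity.exists_gaussianMixtures_tendsto_of_continuous
    {p : EuclideanSpace ℝ (Fin d) → ℝ} (hp : IsDensity p) (hpc : Continuous p) :
    ∃ g : ℕ → EuclideanSpace ℝ (Fin d) → ℝ, (∀ n, g n ∈ gaussianMixtures d) ∧
      ∀ x, Tendsto (fun n => g n x) atTop (𝓝 (p x)) := by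
  have := hp.isProbabilityMeasure
  have key : ∀ n : ℕ, ∃ g ∈ gaussianMixtures d, ∀ x ∈ Metric.closedBall 0 (n : ℝ),
      dist (∫ y, gaussianDensity y ((((n : ℝ) + 1) ^ 2)⁻¹ • 1) x ∂(densityMeasure p)) (g x)
        < 1 / ((n : ℝ) + 1) := fun n =>
    exists_gaussianMixture_dist_integral_lt _ (posDef_smul_one (by positivity))
      (isCompact_closedBall 0 (n : ℝ)) (by positivity)
  choose g hg hgd using key
  refine ⟨g, hg, fun x => ?_⟩
  have hconv : ∀ S : Matrix (Fin d) (Fin d) ℝ,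
      ∫ y, gaussianDensity y S x ∂(densityMeasure p) = ∫ y, gaussianDensity y S x * p y := by
    intro S
    rw [densityMeasure, integral_withDensity_eq_integral_toReal_smul
      hp.measurable.ennreal_ofReal (ae_of_all _ fun _ => ENNReal.ofReal_lt_top)]
    refine integral_congr_ae (ae_of_all _ fun y => ?_)
    simp [ENNReal.toReal_ofReal (hp.nonneg y), mul_comm]
  have h1 := (tendsto_integral_gaussianDensity_mul hp.integrable hpc x).comp
    (tendsto_atTop_add_const_right atTop (1 : ℝ) (tendsto_natCast_atTop_atTop (R := ℝ)))
  have h2 : Tendsto (fun n : ℕ => dist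
      (∫ y, gaussianDensity y ((((n : ℝ) + 1) ^ 2)⁻¹ • 1) x * p y) (g n x)) atTop (𝓝 0) := by
    refine squeeze_zero' (Eventually.of_forall fun n => dist_nonneg) ?_
      tendsto_one_div_add_atTop_nhds_zero_nat
    filter_upwards [eventually_ge_atTop ⌈‖x‖⌉₊] with n hn
    rw [← hconv]
    exact (hgd n x (by simpa using Nat.ceil_le.1 hn)).le
  exact tendsto_of_tendsto_of_dist h1 h2

/-- Every density `f` is an almost everywhere limit of finite Gaussian mixtures. -/
lemma IsDensity.exists_gaussianMixtures_tendsto_ae {f : EuclideanSpace ℝ (Fin d) → ℝ}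
    (hf : IsDensity f) :
    ∃ g : ℕ → EuclideanSpace ℝ (Fin d) → ℝ, (∀ n, g n ∈ gaussianMixtures d) ∧
      ∀ᵐ x ∂(densityMeasure f), Tendsto (fun n => g n x) atTop (𝓝 (f x)) := by
  have := hf.isProbabilityMeasure
  choose p hp hpc hpd using fun n : ℕ =>
    hf.exists_continuous_integral_sub_le (ε := 1 / ((n : ℝ) + 1)) (by positivity)
  have hL1 : Tendsto (fun n => eLpNorm (p n - f) 1 volume) atTop (𝓝 0) := by
    have h0 : Tendsto (fun n : ℕ => ENNReal.ofReal (1 / ((n : ℝ) + 1))) atTop (𝓝 0) := by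
      simpa using ENNReal.tendsto_ofReal tendsto_one_div_add_atTop_nhds_zero_nat
    refine tendsto_of_tendsto_of_tendsto_of_le_of_le tendsto_const_nhds h0 (fun n => zero_le)
      fun n => ?_
    rw [eLpNorm_sub_comm, eLpNorm_one_eq_lintegral_enorm]
    simp only [Pi.sub_apply]
    have h1 := ofReal_integral_norm_eq_lintegral_enorm (hf.integrable.sub (hp n).integrable)
    simp only [Pi.sub_apply] at h1
    rw [← h1]
    exact ENNReal.ofReal_le_ofReal (hpd n)
  obtain ⟨ns, -, hns⟩ := (tendstoInMeasure_of_tendsto_eLpNorm one_ne_zero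
    (fun n => (hpc n).aestronglyMeasurable) hf.measurable.aestronglyMeasurable
    hL1).exists_seq_tendsto_ae
  have hac : densityMeasure f ≪ volume := withDensity_absolutelyContinuous _ _
  refine exists_seq_tendsto_ae_of_tendsto_ae
    (fun g hg => (gaussianMixtures_continuous hg).aestronglyMeasurable) (hac.ae_le hns)
    fun n => ?_
  obtain ⟨g, hg, hgt⟩ := (hp (ns n)).exists_gaussianMixtures_tendsto_of_continuous (hpc (ns n))
  exact ⟨g, hg, ae_of_all _ hgt⟩

end Approximation

/-! ### Integrability of `log⁺ f` -/

section Entropy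

variable {d : ℕ} {f : EuclideanSpace ℝ (Fin d) → ℝ}

lemma volume_closedCube (a : EuclideanSpace ℝ (Fin d)) (s : ℝ) :
    volume (closedCube a s) = ENNReal.ofReal s ^ d := by
  have h : closedCube a s = WithLp.ofLp ⁻¹' Icc a.ofLp (fun i => a i + s) := by
    ext x
    simp only [closedCube, Set.mem_ofPred_eq, mem_Icc, mem_preimage, Pi.le_def, forall_and]
  rw [h, (PiLp.volume_preserving_ofLp (Fin d)).measure_preimage
    measurableSet_Icc.nullMeasurableSet, Real.volume_Icc_pi]
  simp

/-- The infimum of a density over a cube is at most the reciprocal of the volume of the cube. -/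
lemma IsDensity.iInf_closedCube_le (hf : IsDensity f) (a : EuclideanSpace ℝ (Fin d)) {s : ℝ}
    (hs : 0 < s) : ⨅ z ∈ closedCube a s, ENNReal.ofReal (f z) ≤ ENNReal.ofReal (s ^ d)⁻¹ := by
  have hpos : 0 < s ^ d := by positivity
  rw [ENNReal.ofReal_inv_of_pos hpos, ENNReal.le_inv_iff_mul_le, ENNReal.ofReal_pow hs.le,
    ← volume_closedCube a s, ← setLIntegral_const]
  have hm : MeasurableSet (closedCube a s) := by
    have : closedCube a s = ⋂ i, {x | x i ∈ Icc (a i) (a i + s)} := by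
      ext x; simp [closedCube]
    rw [this]
    exact MeasurableSet.iInter fun i =>
      measurableSet_Icc.preimage (by fun_prop : Measurable fun x : EuclideanSpace ℝ (Fin d) => x i)
  calc ∫⁻ _ in closedCube a s, ⨅ z ∈ closedCube a s, ENNReal.ofReal (f z)
      ≤ ∫⁻ x in closedCube a s, ENNReal.ofReal (f x) :=
        setLIntegral_mono' hm fun x hx => iInf₂_le x hx
    _ ≤ ∫⁻ x, ENNReal.ofReal (f x) := setLIntegral_le_lintegral _ _
    _ = 1 := hf.lintegral_eq_one

/-- Since the infimum of `f` over a cube of side `r` is at most `r⁻ᵈ`, the logarithm of `f` is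
bounded above by the local log-oscillation plus a constant. -/
lemma FSSA.lintegral_log_lt_top (hf : FSSA f) :
    ∫⁻ x, ENNReal.ofReal (Real.log (f x)) ∂(densityMeasure f) < ∞ := by
  obtain ⟨r, C, -, -, -, hr, hC, -, hD, -⟩ := hf.exists_scale
  have := hf.isDensity.isProbabilityMeasure
  obtain ⟨b, hb, hb0⟩ : ∃ b : ℝ, b = (r ^ d)⁻¹ ∧ 0 < b := ⟨_, rfl, by positivity⟩
  have hms : MeasurableSet (posSupp f) := measurableSet_lt measurable_const hf.isDensity.measurable
  have hae : ∀ᵐ x ∂(densityMeasure f), x ∈ posSupp f :=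
    ae_densityMeasure_pos hf.isDensity.measurable
  rw [← Measure.restrict_eq_self_of_ae_mem hae]
  -- `logOsc` is only known to be measurable on the support, so the constant is the summand that
  -- is integrated separately.
  refine lt_of_le_of_lt (setLIntegral_mono' hms (g := fun y =>
    (logOsc f (C y) y).toENNReal + ENNReal.ofReal (Real.log b)) fun y hy => ?_) ?_
  · obtain ⟨-, a, ha⟩ := hC y hy
    have hy0 : 0 < f y := hy
    have h1 : ((Real.log (f y / b) : ℝ) : EReal) ≤ logOsc f (C y) y := by
      rw [← ENNReal.log_ofReal_of_pos (div_pos hy0 hb0), ENNReal.ofReal_div_of_pos hb0, logOsc, ha]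
      refine ENNReal.log_le_log (ENNReal.div_le_div_left ?_ _)
      rw [hb]
      exact hf.isDensity.iInf_closedCube_le a hr
    have h2 := EReal.toENNReal_le_toENNReal h1
    rw [EReal.toENNReal_of_ne_top (EReal.coe_ne_top _), EReal.toReal_coe] at h2
    calc ENNReal.ofReal (Real.log (f y))
        = ENNReal.ofReal (Real.log (f y / b) + Real.log b) := by
          rw [Real.log_div hy0.ne' hb0.ne', sub_add_cancel]
      _ ≤ ENNReal.ofReal (Real.log (f y / b)) + ENNReal.ofReal (Real.log b) :=
          ENNReal.ofReal_add_le
      _ ≤ _ := by gcongr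
  · rw [lintegral_add_right _ measurable_const]
    refine ENNReal.add_lt_top.2 ⟨hD, ?_⟩
    rw [lintegral_const]
    exact ENNReal.mul_lt_top ENNReal.ofReal_lt_top (measure_lt_top _ _)

end Entropy

/-! ### Approximation in divergence -/

section Divergence

variable {d : ℕ} {f : EuclideanSpace ℝ (Fin d) → ℝ}

lemma lintegral_norm_sq_densityMeasure (hf : IsDensity f) :
    ∫⁻ x, ENNReal.ofReal (‖x‖ ^ 2) ∂(densityMeasure f) =
      ∫⁻ x, ENNReal.ofReal (‖x‖ ^ 2 * f x) := by
  rw [lintegral_densityMeasure hf.measurable (by fun_prop)]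
  refine lintegral_congr fun x => ?_
  rw [← ENNReal.ofReal_mul (hf.nonneg x), mul_comm]

/-- A density with finite second moment and integrable `f log⁺ f` is approximated in divergence up
to `-log (1 - δ)` by `(1 - δ) • gₙ + δ • φ`, where `gₙ → f` almost everywhere and `φ` is the
standard Gaussian: the component `φ` bounds `log (f / ·)` above by an integrable function, so that
dominated convergence applies. -/
lemma iInf_kl_le (hf : IsDensity f)
    (hlog : ∫⁻ x, ENNReal.ofReal (Real.log (f x)) ∂(densityMeasure f) < ∞)
    (hmom : ∫⁻ x, ENNReal.ofReal (‖x‖ ^ 2 * f x) < ∞) {δ : ℝ} (hδ : 0 < δ) (hδ1 : δ < 1) :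
    ⨅ g ∈ gaussianMixtures d, kl f g ≤ ENNReal.ofReal (-Real.log (1 - δ)) := by
  have := hf.isProbabilityMeasure
  obtain ⟨g, hg, hgf⟩ := hf.exists_gaussianMixtures_tendsto_ae
  have hφM : (gaussianDensity (0 : EuclideanSpace ℝ (Fin d)) 1) ∈ gaussianMixtures d :=
    gaussianDensity_mem_gaussianMixtures 0 Matrix.PosDef.one
  set φ : EuclideanSpace ℝ (Fin d) → ℝ := gaussianDensity 0 1 with hφ
  have hφ0 : ∀ x, 0 < φ x := gaussianMixtures_pos hφM
  obtain ⟨b, hb, hb0⟩ : ∃ b : ℝ, (∀ x, φ x = b * Real.exp (-2⁻¹ * ‖x‖ ^ 2)) ∧ 0 < b :=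
    ⟨(2 * Real.pi) ^ (-(d : ℝ) / 2), fun x => by
      simpa using gaussianDensity_smul_one 0 one_pos x, by positivity⟩
  let G : ℕ → EuclideanSpace ℝ (Fin d) → ℝ := fun n x => (1 - δ) * g n x + δ * φ x
  have hGM : ∀ n, G n ∈ gaussianMixtures d := fun n =>
    convex_gaussianMixtures (hg n) hφM (by linarith) hδ.le (by ring)
  have hGm : ∀ n, Measurable (G n) := fun n => (gaussianMixtures_continuous (hGM n)).measurable
  have hG0 : ∀ n x, 0 < G n x := fun n => gaussianMixtures_pos (hGM n)
  have hpos := ae_densityMeasure_pos hf.measurable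
  have hlim : Tendsto (fun n => ∫⁻ x, ENNReal.ofReal (Real.log (f x / G n x)) ∂(densityMeasure f))
      atTop (𝓝 (∫⁻ x, ENNReal.ofReal (Real.log (f x / ((1 - δ) * f x + δ * φ x)))
        ∂(densityMeasure f))) := by
    refine tendsto_lintegral_of_dominated_convergence (fun x => ENNReal.ofReal (Real.log (f x)) +
      (ENNReal.ofReal (‖x‖ ^ 2) + ENNReal.ofReal (-Real.log (δ * b))))
      (fun n => (hf.measurable.div (hGm n)).log.ennreal_ofReal) (fun n => ?_) ?_ ?_
    · filter_upwards [hpos] with x hx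
      have h1 : δ * φ x ≤ G n x := by
        have := mul_pos (sub_pos.2 hδ1) (gaussianMixtures_pos (hg n) x)
        simp only [G]; linarith
      have h2 : Real.log (δ * φ x) = Real.log (δ * b) + -2⁻¹ * ‖x‖ ^ 2 := by
        rw [hb, ← mul_assoc, Real.log_mul (by positivity) (Real.exp_ne_zero _), Real.log_exp]
      have h3 : Real.log (f x / G n x)
          ≤ Real.log (f x) + (‖x‖ ^ 2 + -Real.log (δ * b)) := by
        rw [Real.log_div hx.ne' (hG0 n x).ne']
        have := Real.log_le_log (mul_pos hδ (hφ0 x)) h1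
        nlinarith [sq_nonneg ‖x‖]
      exact (ENNReal.ofReal_le_ofReal h3).trans (ENNReal.ofReal_add_le.trans (by
        gcongr; exact ENNReal.ofReal_add_le))
    · have hm : Measurable fun x => ENNReal.ofReal (Real.log (f x)) :=
        hf.measurable.log.ennreal_ofReal
      rw [lintegral_add_left hm, lintegral_add_right _ measurable_const,
        lintegral_norm_sq_densityMeasure hf, lintegral_const]
      exact (ENNReal.add_lt_top.2 ⟨hlog, ENNReal.add_lt_top.2
        ⟨hmom, ENNReal.mul_lt_top ENNReal.ofReal_lt_top (measure_lt_top _ _)⟩⟩).ne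
    · filter_upwards [hpos, hgf] with x hx hxl
      have hden : 0 < (1 - δ) * f x + δ * φ x :=
        add_pos (mul_pos (sub_pos.2 hδ1) hx) (mul_pos hδ (hφ0 x))
      refine ENNReal.tendsto_ofReal (Tendsto.log ?_ (div_pos hx hden).ne')
      exact tendsto_const_nhds.div ((hxl.const_mul _).add_const _) hden.ne'
  have hbound : ∫⁻ x, ENNReal.ofReal (Real.log (f x / ((1 - δ) * f x + δ * φ x)))
      ∂(densityMeasure f) ≤ ENNReal.ofReal (-Real.log (1 - δ)) := by
    calc _ ≤ ∫⁻ _, ENNReal.ofReal (-Real.log (1 - δ)) ∂(densityMeasure f) := by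
          refine lintegral_mono_ae ?_
          filter_upwards [hpos] with x hx
          refine ENNReal.ofReal_le_ofReal ?_
          have h1 : 0 < (1 - δ) * f x := mul_pos (sub_pos.2 hδ1) hx
          have h2 := mul_pos hδ (hφ0 x)
          rw [← Real.log_inv]
          refine Real.log_le_log (by positivity) ?_
          calc f x / ((1 - δ) * f x + δ * φ x) ≤ f x / ((1 - δ) * f x) := by
                gcongr; linarith
            _ = (1 - δ)⁻¹ := by field_simp
      _ = _ := by simp
  refine le_trans (ge_of_tendsto' hlim fun n => ?_) hbound
  exact (iInf₂_le (G n) (hGM n)).trans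
    (kl_le_lintegral_log hf (gaussianMixtures_isDensity (hGM n)) (hG0 n))

end Divergence

/-! ### Finite divergence and the second moment -/

section Characterization

variable {d : ℕ} {f : EuclideanSpace ℝ (Fin d) → ℝ}

lemma IsDensity.lintegral_norm_sq_lt_top_of_kl_lt_top (hf : IsDensity f)
    {g : EuclideanSpace ℝ (Fin d) → ℝ} (hg : g ∈ gaussianMixtures d) (hkl : kl f g < ∞) :
    ∫⁻ x, ENNReal.ofReal (‖x‖ ^ 2 * f x) < ∞ := by
  obtain ⟨c, hc, hi⟩ := exists_integrable_exp_mul_gaussianMixture hg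
  have h := lintegral_mul_lt_top_of_kl_lt_top hf.measurable hf.nonneg
    (gaussianMixtures_continuous hg).measurable (gaussianMixtures_pos hg) hkl hi
  simp_rw [mul_assoc, ENNReal.ofReal_mul hc.le] at h
  rw [lintegral_const_mul' _ _ ENNReal.ofReal_ne_top] at h
  exact ENNReal.lt_top_of_mul_ne_top_right h.ne (ENNReal.ofReal_pos.2 hc).ne'

lemma iInf_kl_eq_zero (hf : IsDensity f)
    (hlog : ∫⁻ x, ENNReal.ofReal (Real.log (f x)) ∂(densityMeasure f) < ∞)
    (hmom : ∫⁻ x, ENNReal.ofReal (‖x‖ ^ 2 * f x) < ∞) :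
    ⨅ g ∈ gaussianMixtures d, kl f g = 0 := by
  have hlim : Tendsto (fun δ : ℝ => ENNReal.ofReal (-Real.log (1 - δ))) (𝓝[>] 0) (𝓝 0) := by
    have h : Tendsto (fun δ : ℝ => -Real.log (1 - δ)) (𝓝 0) (𝓝 (-Real.log (1 - 0))) :=
      ((tendsto_const_nhds.sub tendsto_id).log (by norm_num)).neg
    simpa using ENNReal.tendsto_ofReal (h.mono_left nhdsWithin_le_nhds)
  refine le_antisymm (ge_of_tendsto hlim ?_) zero_le
  filter_upwards [Ioo_mem_nhdsGT one_pos] with δ hδ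
  exact iInf_kl_le hf hlog hmom hδ.1 hδ.2

end Characterization

end GMMKL

theorem theorem4p9 {d : ℕ} (f : EuclideanSpace ℝ (Fin d) → ℝ) (hf : GMMKL.FSSA f) :
    (⨅ g ∈ GMMKL.gaussianMixtures d, GMMKL.kl f g) = 0 ↔
      ∫⁻ x, ENNReal.ofReal (‖x‖ ^ 2 * f x) < ∞ := by
  refine ⟨fun h => ?_, GMMKL.iInf_kl_eq_zero hf.isDensity hf.lintegral_log_lt_top⟩
  have hlt : (⨅ g ∈ GMMKL.gaussianMixtures d, GMMKL.kl f g) < ∞ := h ▸ ENNReal.zero_lt_top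
  simp only [iInf_lt_iff] at hlt
  obtain ⟨g, hg, hkl⟩ := hlt
  exact hf.isDensity.lintegral_norm_sq_lt_top_of_kl_lt_top hg hkl
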